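/- Let $\mathbb T=\mathbb R/2\pi\mathbb Z$ and let $(c_k)_{k\in\mathbb Z}$ be a sequence of complex numbers. Suppose that 1. $\sum_{k\in\mathbb Z} c_k e^{ikt}$ is a Fourier–Stieltjes series, that is, there is a (finite) complex Borel measure $\mu$ on $\mathbb T$ with $c_k=\frac1{2\pi}\int_{\mathbb T}e^{-ikt}\,d\mu(t)$ for all $k\in\mathbb Z$; 2. $(c_k)$ is of bounded variation, that is, $\sum_{k=-\infty}^{\infty}|c_k-c_{k+1}|<\infty$; 3. $\lim_{k\to\infty}(c_k-c_{-k})=0$. Then the limit $L=\lim_{|k|\to\infty}c_k$ exists, and $\sum_{k\in\mathbb Z}(c_k-L)e^{ikt}$ is a Fourier series, that is, there is an integrable function $f:\mathbb T\to\mathbb C$ with $c_k-L=\frac1{2\pi}\int_{\mathbb T}f(t)e^{-ikt}\,dt$ for all $k\in\mathbb Z$. -/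

import Mathlib

open MeasureTheory Filter Topology

namespace TrigSeries

/-- The period `2π` is positive (needed for Haar measure on `AddCircle (2 * π)`). -/
instance instFactTwoPiPos : Fact (0 < 2 * Real.pi) := ⟨Real.two_pi_pos⟩

/-- The circle `𝕋 = ℝ / 2πℤ`, i.e. `[-π, π)` with endpoints identified, with its Borel sets. -/
abbrev Circle2Pi : Type := AddCircle (2 * Real.pi)

/-- The `k`-th Fourier–Stieltjes coefficient `(1 / 2π) ∫_𝕋 e^{-ikt} dμ(t)` of a complex Borel
measure `μ` on `𝕋`. Here `fourier (-k)` is the character `t ↦ e^{-ikt}`. -/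
noncomputable def fourierStieltjesCoeff (μ : ComplexMeasure Circle2Pi) (k : ℤ) : ℂ :=
  1 / (2 * (Real.pi : ℂ)) *
    μ.integral (fun t : Circle2Pi => (fourier (-k) t : ℂ)) (ContinuousLinearMap.mul ℝ ℂ)

/-- `∑ c_k e^{ikt}` is the Fourier–Stieltjes series of some complex Borel measure on `𝕋`. -/
def IsFourierStieltjesSeries (c : ℤ → ℂ) : Prop :=
  ∃ μ : ComplexMeasure Circle2Pi, ∀ k : ℤ, c k = fourierStieltjesCoeff μ k

/-- `∑ c_k e^{ikt}` is the Fourier series of some integrable `f : 𝕋 → ℂ`, that is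
`c_k = (1 / 2π) ∫_𝕋 f(t) e^{-ikt} dt` for all `k`. The measure `AddCircle.haarAddCircle` is
`dt / 2π`, and `fourierCoeff f k` is the integral of `e^{-ikt} f(t)` against it. -/
def IsFourierSeries (c : ℤ → ℂ) : Prop :=
  ∃ f : Circle2Pi → ℂ, Integrable f AddCircle.haarAddCircle ∧ ∀ k : ℤ, c k = fourierCoeff f k

/-- The class `bv` of two-sided sequences: `∑_{k ∈ ℤ} |c_k - c_{k+1}| < ∞`. -/
def IsBV (c : ℤ → ℂ) : Prop :=
  Summable fun k : ℤ => ‖c k - c (k + 1)‖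

end TrigSeries

open AddCircle

/-! The differences `c k - c (k + 1)` are the Fourier–Stieltjes coefficients of `(1 - e^{-it}) dμ`.
Being absolutely summable, they are also the coefficients of a continuous `g`, so by uniqueness `(1
- e^{-it}) dμ = g dt`, up to normalization. The factor vanishes only at `t = 0`, hence `μ` is `g /
(1 - e^{-it}) dt` plus a point mass at `0`. The mass contributes the constant `L` to every
coefficient, and Riemann–Lebesgue sends the rest to `0`. -/

/-- Pairing a continuous function on a compact space with an integrable function. -/
noncomputable def integralMulCLM {X : Type*} [TopologicalSpace X] [CompactSpace X]
    [MeasurableSpace X] [BorelSpace X] (ν : Measure X) {F : X → ℂ} (hF : Integrable F ν) :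
    C(X, ℂ) →L[ℂ] ℂ :=
  have hint (φ : C(X, ℂ)) : Integrable (fun x => φ x * F x) ν :=
    hF.bdd_mul φ.continuous.aestronglyMeasurable (Eventually.of_forall φ.norm_coe_le_norm)
  LinearMap.mkContinuous
    { toFun := fun φ => ∫ x, φ x * F x ∂ν
      map_add' := fun φ ψ => by
        simp only [ContinuousMap.add_apply, add_mul]
        exact integral_add (hint φ) (hint ψ)
      map_smul' := fun a φ => by
        simp only [ContinuousMap.smul_apply, smul_eq_mul, mul_assoc, RingHom.id_apply]
        exact integral_const_mul _ _ }
    (∫ x, ‖F x‖ ∂ν) fun φ => by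
      calc ‖∫ x, φ x * F x ∂ν‖ ≤ ∫ x, ‖φ‖ * ‖F x‖ ∂ν := by
            refine norm_integral_le_of_norm_le (hF.norm.const_mul _) (Eventually.of_forall fun x => ?_)
            rw [norm_mul]
            gcongr
            exact φ.norm_coe_le_norm x
        _ = (∫ x, ‖F x‖ ∂ν) * ‖φ‖ := by rw [integral_const_mul, mul_comm]

theorem integralMulCLM_apply {X : Type*} [TopologicalSpace X] [CompactSpace X]
    [MeasurableSpace X] [BorelSpace X] {ν : Measure X} {F : X → ℂ} (hF : Integrable F ν)
    (φ : C(X, ℂ)) : integralMulCLM ν hF φ = ∫ x, φ x * F x ∂ν := rfl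

/-- Indicators of closed sets are bounded pointwise limits of continuous functions, so by dominated
convergence `F` integrates to zero over every closed set. -/
theorem ae_eq_zero_of_integralMulCLM_eq_zero {X : Type*} [TopologicalSpace X] [CompactSpace X]
    [MeasurableSpace X] [BorelSpace X] [HasOuterApproxClosed X] {ν : Measure X} {F : X → ℂ}
    (hF : Integrable F ν) (h : integralMulCLM ν hF = 0) : F =ᵐ[ν] 0 := by
  refine ae_eq_zero_of_forall_setIntegral_isClosed_eq_zero hF fun s hs => ?_
  have hlim : Tendsto (fun n => ∫ x, ((hs.apprSeq n x : ℝ) : ℂ) * F x ∂ν) atTop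
      (𝓝 (∫ x, s.indicator F x ∂ν)) := by
    refine tendsto_integral_of_dominated_convergence (fun x => ‖F x‖) (fun n => ?_) hF.norm
      (fun n => Eventually.of_forall fun x => ?_) (Eventually.of_forall fun x => ?_)
    · refine AEStronglyMeasurable.mul (Continuous.aestronglyMeasurable ?_) hF.aestronglyMeasurable
      have := (hs.apprSeq n).continuous
      fun_prop
    · rw [norm_mul]
      refine mul_le_of_le_one_left (norm_nonneg _) ?_
      have : hs.apprSeq n x ≤ 1 := HasOuterApproxClosed.apprSeq_apply_le_one hs n x
      simpa using this
    · have h1 := (tendsto_pi_nhds.1 (HasOuterApproxClosed.tendsto_apprSeq hs)) x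
      have h2 := ((Complex.continuous_ofReal.comp NNReal.continuous_coe).continuousAt.tendsto.comp
        h1).mul_const (F x)
      have h3 : (Complex.ofReal ∘ NNReal.toReal) (s.indicator (fun _ => 1) x) * F x =
          s.indicator F x := by
        by_cases hx : x ∈ s <;> simp [hx]
      rw [h3] at h2
      exact h2
  have hzero (n : ℕ) : ∫ x, ((hs.apprSeq n x : ℝ) : ℂ) * F x ∂ν = 0 := by
    have hc : Continuous fun x => ((hs.apprSeq n x : ℝ) : ℂ) := by
      have := (hs.apprSeq n).continuous
      fun_prop
    exact DFunLike.congr_fun h ⟨_, hc⟩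
  simp only [hzero] at hlim
  rw [← integral_indicator hs.measurableSet]
  exact (tendsto_nhds_unique hlim tendsto_const_nhds)

/-- An integrable function all of whose Fourier coefficients with respect to a measure vanish is
zero almost everywhere. -/
theorem ae_eq_zero_of_integral_fourier_mul_eq_zero {T : ℝ} [Fact (0 < T)]
    {ν : Measure (AddCircle T)} {F : AddCircle T → ℂ} (hF : Integrable F ν)
    (h : ∀ k : ℤ, ∫ x, fourier k x * F x ∂ν = 0) : F =ᵐ[ν] 0 := by
  refine ae_eq_zero_of_integralMulCLM_eq_zero hF (ContinuousLinearMap.ext_on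
    (s := Set.range (fourier (T := T))) ?_ ?_)
  · rw [Submodule.dense_iff_topologicalClosure_eq_top]
    exact span_fourier_closure_eq_top
  · rintro _ ⟨k, rfl⟩
    exact h k

/-- The sum of an absolutely convergent trigonometric series has the prescribed Fourier
coefficients. -/
theorem exists_continuousMap_fourierCoeff_eq {T : ℝ} [Fact (0 < T)] {d : ℤ → ℂ}
    (hd : Summable fun k => ‖d k‖) : ∃ g : C(AddCircle T, ℂ), ∀ k, fourierCoeff g k = d k := by
  have hs : Summable fun k => d k • (fourier k : C(AddCircle T, ℂ)) :=
    Summable.of_norm (by simpa only [norm_smul, fourier_norm, mul_one] using hd)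
  refine ⟨∑' k, d k • fourier k, fun k => ?_⟩
  have hi : Integrable (fun t => fourier (-k) t) (haarAddCircle (T := T)) :=
    (map_continuous (fourier (-k))).integrable_of_hasCompactSupport (HasCompactSupport.of_compactSpace _)
  have hc (φ : C(AddCircle T, ℂ)) : fourierCoeff φ k = integralMulCLM haarAddCircle hi φ := by
    simp only [fourierCoeff, integralMulCLM_apply, smul_eq_mul, mul_comm]
  -- The coefficient functional is continuous, so it passes through the uniformly convergent series;
  -- orthogonality leaves one term.
  rw [hc, ContinuousLinearMap.map_tsum _ hs, tsum_eq_single k]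
  · rw [map_smul, ← hc, fourierCoeff_fourier]
    simp
  · intro j hj
    rw [map_smul, ← hc, fourierCoeff_fourier]
    simp [hj.symm]

/-- The **Riemann–Lebesgue lemma** for Fourier coefficients. -/
theorem tendsto_fourierCoeff_cofinite {T : ℝ} [hT : Fact (0 < T)] (f : AddCircle T → ℂ) :
    Tendsto (fourierCoeff f) cofinite (𝓝 0) := by
  have hT0 : T ≠ 0 := hT.out.ne'
  -- Cut off to one period, so that the coefficients are samples at `n / T` of a Fourier transform
  -- on `ℝ`.
  let F : ℝ → ℂ := (Set.Ioc 0 T).indicator fun x => f x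
  have hcoeff (n : ℤ) : fourierCoeff f n =
      (1 / T) • ∫ v : ℝ, Real.fourierChar (-(v * (n / T))) • F v := by
    rw [fourierCoeff_eq_intervalIntegral f n 0, zero_add,
      intervalIntegral.integral_of_le hT.out.le, ← integral_indicator measurableSet_Ioc]
    congr 2
    ext x
    by_cases hx : x ∈ Set.Ioc 0 T
    · simp only [F, Set.indicator_of_mem hx, Circle.smul_def, Real.fourierChar_apply,
        fourier_coe_apply]
      congr 2
      push_cast
      field_simp
    · simp [F, hx]
  have htend : Tendsto (fun n : ℤ => (n / T : ℝ)) cofinite (cocompact ℝ) := by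
    have h1 : Tendsto (fun n : ℤ => (n : ℝ)) cofinite (cocompact ℝ) := Int.tendsto_coe_cofinite
    have h2 := (Homeomorph.mulRight₀ T⁻¹ (inv_ne_zero hT0)).isClosedEmbedding.tendsto_cocompact
    simpa [div_eq_mul_inv] using! h2.comp h1
  have := ((Real.tendsto_integral_exp_smul_cocompact F).comp htend).const_smul (1 / T)
  rw [smul_zero] at this
  exact this.congr fun n => (hcoeff n).symm

/-- Integration against the vector measure with density `h` with respect to `ν`. -/
theorem integral_withDensityᵥ_eq {X : Type*} {mX : MeasurableSpace X} {ν : Measure X} {h : X → ℂ}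
    (hh : Integrable h ν) {f : X → ℂ} (hf : StronglyMeasurable f) {C : ℝ} (hC : 0 ≤ C)
    (hfC : ∀ x, ‖f x‖ ≤ C) :
    (ν.withDensityᵥ h).integral f (ContinuousLinearMap.mul ℝ ℂ) = ∫ x, f x * h x ∂ν := by
  -- Finite variation makes simple functions integrable and allows bounded convergence.
  have hfin : IsFiniteMeasure (ν.withDensityᵥ h).variation := by
    rw [Measure.variation_withDensityᵥ hh]
    exact isFiniteMeasure_withDensity hh.2.ne
  have hint (s : SimpleFunc X ℂ) : Integrable (fun x => s x * h x) ν := by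
    obtain ⟨C, hC⟩ := s.exists_forall_norm_le
    exact hh.bdd_mul s.aestronglyMeasurable (Eventually.of_forall hC)
  have hsimple (s : SimpleFunc X ℂ) :
      (ν.withDensityᵥ h).integral s (ContinuousLinearMap.mul ℝ ℂ) = ∫ x, s x * h x ∂ν := by
    classical
    induction s using SimpleFunc.induction with
    | @const c s hs =>
      rw [SimpleFunc.coe_piecewise, SimpleFunc.coe_const, SimpleFunc.const_zero,
        SimpleFunc.coe_zero, Set.piecewise_eq_indicator]
      refine (VectorMeasure.integral_indicator_const c hs).trans ?_
      rw [withDensityᵥ_apply hh hs, ContinuousLinearMap.mul_apply', ← integral_const_mul,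
        ← integral_indicator hs]
      congr 1
      ext x
      by_cases hx : x ∈ s <;> simp [hx]
    | @add s t _ hs ht =>
      rw [SimpleFunc.coe_add, VectorMeasure.integral_add s.integrable_of_isFiniteMeasure
        t.integrable_of_isFiniteMeasure, hs, ht, ← integral_add (hint s) (hint t)]
      simp only [Pi.add_apply, add_mul]
  have hlim (x : X) := hf.tendsto_approxBounded_of_norm_le (hfC x)
  have h1 : Tendsto (fun n => (ν.withDensityᵥ h).integral (hf.approxBounded C n)
      (ContinuousLinearMap.mul ℝ ℂ)) atTop
      (𝓝 ((ν.withDensityᵥ h).integral f (ContinuousLinearMap.mul ℝ ℂ))) :=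
    VectorMeasure.tendsto_integral_filter_of_norm_le_const
    (Eventually.of_forall fun n => (hf.approxBounded C n).aestronglyMeasurable)
    ⟨C, Eventually.of_forall fun n => Eventually.of_forall (hf.norm_approxBounded_le hC n)⟩
    (Eventually.of_forall hlim)
  have h2 : Tendsto (fun n => ∫ x, hf.approxBounded C n x * h x ∂ν) atTop
      (𝓝 (∫ x, f x * h x ∂ν)) := by
    refine tendsto_integral_of_dominated_convergence (fun x => C * ‖h x‖)
      (fun n => (hint _).aestronglyMeasurable) (hh.norm.const_mul _)
      (fun n => Eventually.of_forall fun x => ?_)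
      (Eventually.of_forall fun x => (hlim x).mul_const _)
    rw [norm_mul]
    gcongr
    exact hf.norm_approxBounded_le hC n x
  exact tendsto_nhds_unique h1 (h2.congr fun n => (hsimple _).symm)

/-- A complex measure has an integrable density with respect to any σ-finite measure dominating the
total variations of its real and imaginary parts. -/
theorem exists_withDensityᵥ_eq {X : Type*} {mX : MeasurableSpace X} (μ : ComplexMeasure X)
    {ν : Measure X} [SigmaFinite ν] (hre : (ComplexMeasure.re μ).totalVariation ≪ ν)
    (him : (ComplexMeasure.im μ).totalVariation ≪ ν) :
    ∃ h : X → ℂ, Integrable h ν ∧ ν.withDensityᵥ h = μ := by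
  have hν : ν.toENNRealVectorMeasure.ennrealToMeasure = ν := VectorMeasure.equivMeasure.right_inv ν
  refine ⟨μ.rnDeriv ν, μ.integrable_rnDeriv ν, ?_⟩
  have : μ.HaveLebesgueDecomposition ν := ⟨inferInstance, inferInstance⟩
  have hs (s : SignedMeasure X) (hs : s.totalVariation ≪ ν) : ν.withDensityᵥ (s.rnDeriv ν) = s :=
    s.withDensityᵥ_rnDeriv_eq ν
      ((SignedMeasure.absolutelyContinuous_ennreal_iff _ _).2 (by rwa [hν]))
  -- The density part is already all of `s`, so nothing is left for the singular part.
  have hz (s : SignedMeasure X) (h : s.totalVariation ≪ ν) : s.singularPart ν = 0 := by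
    have := s.singularPart_add_withDensity_rnDeriv_eq ν
    rwa [hs s h, add_eq_right] at this
  have hsing : μ.singularPart ν = 0 := by
    rw [ComplexMeasure.singularPart, hz _ hre, hz _ him]
    rfl
  have := ComplexMeasure.singularPart_add_withDensity_rnDeriv_eq (c := μ) (μ := ν)
  rwa [hsing, zero_add] at this

theorem one_sub_fourier_neg_one_ne_zero {T : ℝ} [hT : Fact (0 < T)] {t : AddCircle T}
    (ht : t ≠ 0) : (1 : ℂ) - fourier (-1) t ≠ 0 := by
  intro h
  have h1 : toCircle (-t) = 1 := by
    have := (sub_eq_zero.1 h).symm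
    rw [fourier_apply, neg_one_zsmul] at this
    exact Circle.ext (this.trans Circle.coe_one.symm)
  have h2 := AddCircle.injective_toCircle hT.out.ne' (h1.trans AddCircle.toCircle_zero.symm)
  exact ht (neg_eq_zero.1 h2)

/-- If the Fourier–Stieltjes coefficients of `h dν` have absolutely summable differences, then
`h dν` is the sum of an absolutely continuous measure and a point mass at `0`. -/
theorem exists_integrable_fourierCoeff_add_const {T : ℝ} [Fact (0 < T)]
    {ν : Measure (AddCircle T)} [IsFiniteMeasure ν] (hν : haarAddCircle ≪ ν)
    {h : AddCircle T → ℂ} (hh : Integrable h ν)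
    (hbv : Summable fun k : ℤ =>
      ‖∫ t, fourier (-k) t * h t ∂ν - ∫ t, fourier (-(k + 1)) t * h t ∂ν‖) :
    ∃ (f : AddCircle T → ℂ) (a : ℂ), Integrable f haarAddCircle ∧
      ∀ k : ℤ, ∫ t, fourier (-k) t * h t ∂ν = fourierCoeff f k + a := by
  have hfm (k : ℤ) {F : AddCircle T → ℂ} (hF : Integrable F ν) :
      Integrable (fun t => fourier k t * F t) ν :=
    hF.bdd_mul (c := 1) (map_continuous (fourier k)).aestronglyMeasurable
      (Eventually.of_forall fun t => by rw [fourier_apply, Circle.norm_coe])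
  -- `p` is the density of Haar measure, so `g dt` and `h dν` can be compared under `ν`.
  let p : AddCircle T → ℝ := fun t => (haarAddCircle.rnDeriv ν t).toReal
  obtain ⟨g, hg⟩ := exists_continuousMap_fourierCoeff_eq (T := T) hbv
  have hgi : Integrable (fun t => p t • g t) ν := by
    refine (integrable_rnDeriv_smul_iff hν).2 ?_
    exact (map_continuous g).integrable_of_hasCompactSupport (HasCompactSupport.of_compactSpace _)
  have hhi : Integrable (fun t => (1 - fourier (-1) t) * h t) ν := by
    simp only [sub_mul, one_mul]
    exact hh.sub (hfm _ hh)
  have hzero : (fun t => (1 - fourier (-1) t) * h t - p t • g t) =ᵐ[ν] 0 := by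
    refine ae_eq_zero_of_integral_fourier_mul_eq_zero (hhi.sub hgi) fun k => ?_
    have hgk : ∫ t, fourier k t * (p t • g t) ∂ν =
        ∫ t, fourier k t * h t ∂ν - ∫ t, fourier (k - 1) t * h t ∂ν := by
      have h1 := hg (-k)
      rw [show -(-k + 1) = k - 1 by ring, neg_neg] at h1
      rw [← h1, fourierCoeff, neg_neg, ← integral_rnDeriv_smul hν]
      simp only [p, mul_smul_comm, smul_eq_mul]
    have hhk : ∫ t, fourier k t * ((1 - fourier (-1) t) * h t) ∂ν =
        ∫ t, fourier k t * h t ∂ν - ∫ t, fourier (k - 1) t * h t ∂ν := by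
      rw [← integral_sub (hfm _ hh) (hfm _ hh)]
      congr 1
      ext t
      rw [sub_eq_add_neg k 1, fourier_add]
      ring
    calc ∫ t, fourier k t * ((1 - fourier (-1) t) * h t - p t • g t) ∂ν
        = ∫ t, fourier k t * ((1 - fourier (-1) t) * h t) ∂ν
          - ∫ t, fourier k t * (p t • g t) ∂ν := by
          rw [← integral_sub (hfm _ hhi) (hfm _ hgi)]
          simp only [mul_sub]
      _ = 0 := by rw [hgk, hhk, sub_self]
  -- At `t = 0` the division by zero gives `f 0 = 0`, matching the indicator in `hpf`.
  let f : AddCircle T → ℂ := fun t => g t / (1 - fourier (-1) t)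
  have hpf : (fun t => p t • f t) =ᵐ[ν] Set.indicator {0}ᶜ h := by
    filter_upwards [hzero] with t ht
    by_cases h0 : t = 0
    · simp [f, h0]
    · rw [Set.indicator_of_mem (by simpa using h0)]
      have hne := one_sub_fourier_neg_one_ne_zero h0
      simp only [Pi.zero_apply, sub_eq_zero] at ht
      simp only [f, ← smul_div_assoc, ← ht]
      field_simp
  -- Integrability of the quotient is inherited from `h`, not from a bound on `1 / (1 - e^{-it})`.
  have hpfi : Integrable (fun t => p t • f t) ν :=
    (hh.indicator (measurableSet_singleton _).compl).congr hpf.symm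
  refine ⟨f, ν.real {0} • h 0, (integrable_rnDeriv_smul_iff hν).1 hpfi, fun k => ?_⟩
  have hf : fourierCoeff f k = ∫ t in {0}ᶜ, fourier (-k) t * h t ∂ν := by
    rw [fourierCoeff, ← integral_rnDeriv_smul hν,
      ← integral_indicator (measurableSet_singleton _).compl]
    refine integral_congr_ae ?_
    filter_upwards [hpf] with t ht
    have : (haarAddCircle.rnDeriv ν t).toReal • (fourier (-k) t • f t) =
        fourier (-k) t * (p t • f t) := by
      simp only [p, mul_smul_comm, smul_eq_mul]
    rw [this, ht]
    by_cases h0 : t = 0 <;> simp [h0]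
  have h0 : ∫ t in {0}, fourier (-k) t * h t ∂ν = ν.real {0} • h 0 := by
    rw [integral_singleton, fourier_eval_zero, one_mul]
  rw [hf, ← h0, add_comm]
  exact (integral_add_compl (measurableSet_singleton _) (hfm _ hh)).symm

theorem mainTheorem6 (c : ℤ → ℂ)
    (hFS : TrigSeries.IsFourierStieltjesSeries c)
    (hbv : TrigSeries.IsBV c)
    (hodd : Tendsto (fun k : ℤ => c k - c (-k)) atTop (𝓝 0)) :
    ∃ L : ℂ, Tendsto c (atBot ⊔ atTop) (𝓝 L) ∧
      TrigSeries.IsFourierSeries (fun k : ℤ => c k - L) := by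
  obtain ⟨μ, hμ⟩ := hFS
  -- One finite measure dominating both `μ` and Haar measure.
  let ν : Measure TrigSeries.Circle2Pi := (ComplexMeasure.re μ).totalVariation +
    (ComplexMeasure.im μ).totalVariation + haarAddCircle
  have hre : (ComplexMeasure.re μ).totalVariation ≤ ν := by
    simp only [ν, add_assoc]
    exact Measure.le_add_right le_rfl
  have him : (ComplexMeasure.im μ).totalVariation ≤ ν :=
    Measure.le_add_right (Measure.le_add_left le_rfl)
  have hhaar : haarAddCircle ≤ ν := Measure.le_add_left le_rfl
  obtain ⟨h, hh, hhμ⟩ := exists_withDensityᵥ_eq μ hre.absolutelyContinuous him.absolutelyContinuous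
  have hπ : (2 * Real.pi : ℂ) ≠ 0 := by
    exact_mod_cast Real.two_pi_pos.ne'
  have hcoeff (k : ℤ) : c k = 1 / (2 * Real.pi) * ∫ t, fourier (-k) t * h t ∂ν := by
    rw [hμ, TrigSeries.fourierStieltjesCoeff]
    nth_rw 1 [← hhμ]
    rw [integral_withDensityᵥ_eq hh (map_continuous (fourier (-k))).stronglyMeasurable zero_le_one
      fun t => by rw [fourier_apply, Circle.norm_coe]]
  have hint (k : ℤ) : ∫ t, fourier (-k) t * h t ∂ν = 2 * Real.pi * c k := by
    rw [hcoeff k]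
    field_simp
  obtain ⟨f, a, hf, hfa⟩ := exists_integrable_fourierCoeff_add_const hhaar.absolutelyContinuous hh
    (by simpa only [hint, ← mul_sub, norm_mul] using Summable.mul_left _ hbv)
  have hc (k : ℤ) : c k = 1 / (2 * Real.pi) * fourierCoeff f k + 1 / (2 * Real.pi) * a := by
    rw [hcoeff, hfa, mul_add]
  refine ⟨1 / (2 * Real.pi) * a, ?_, fun t => 1 / (2 * Real.pi) * f t, hf.const_mul _, fun k => ?_⟩
  · rw [← Int.cofinite_eq]
    have := ((tendsto_fourierCoeff_cofinite f).const_mul (1 / (2 * Real.pi : ℂ))).add_const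
      (1 / (2 * Real.pi) * a)
    rw [mul_zero, zero_add] at this
    exact this.congr fun k => (hc k).symm
  · change c k - _ = _
    rw [fourierCoeff.const_mul, hc, add_sub_cancel_right]
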